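/- Let $(X,d)$ be a compact metric space, let $f\colon X\to X$ be a homeomorphism and let $n\in\mathbb{N}$. Assume that $f$ is $n$-expansive, i.e. there is $c>0$ such that for every $x\in X$ the set $\{y\in X : d(f^m(x),f^m(y))\le c \text{ for all } m\in\mathbb{Z}\}$ contains at most $n$ points. Assume also that $f$ has the shadowing property, i.e. for every $\varepsilon>0$ there is $\delta>0$ such that for every sequence $(x_k)_{k\in\mathbb{Z}}$ in $X$ with $d(f(x_k),x_{k+1})<\delta$ for all $k\in\mathbb{Z}$ there is $y\in X$ with $d(f^k(y),x_k)<\varepsilon$ for all $k\in\mathbb{Z}$. Then both $f$ and $f^{-1}$ have the limit shadowing property, where a homeomorphism $g$ of $X$ is said to have the limit shadowing property if for every sequence $(x_k)_{k\ge 0}$ in $X$ with $d(g(x_k),x_{k+1})\to 0$ as $k\to\infty$ there is $y\in X$ with $d(g^k(y),x_k)\to 0$ as $k\to\infty$. If, in addition, $f$ is topologically mixing (for all non-empty open $U,V\subset X$ there is $k\in\mathbb{N}$ such that $f^j(U)\cap V\neq\emptyset$ for every $j\ge k$), then $f$ has the two-sided limit shadowing property: for every sequence $(x_k)_{k\in\mathbb{Z}}$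 in $X$ with $d(f(x_k),x_{k+1})\to 0$ as $|k|\to\infty$ there is $y\in X$ with $d(f^k(y),x_k)\to 0$ as $|k|\to\infty$. -/

import Mathlib

namespace NExpansive

open Filter Topology

variable {X : Type*} [MetricSpace X]

/-- The dynamic ball `Γ(x, c)`: the points whose whole (two-sided) orbit stays within
distance `c` of the orbit of `x`. Here `f ^ m`, for `m : ℤ`, is the power in the group of
self-homeomorphisms of `X`, i.e. the `m`-th iterate of `f`. -/
def dynamicBall (f : X ≃ₜ X) (x : X) (c : ℝ) : Set X :=
  {y | ∀ m : ℤ, dist ((f ^ m) x) ((f ^ m) y) ≤ c}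

/-- `f` is `n`-expansive: for some `c > 0` every dynamic ball of radius `c` contains at most
`n` different points. -/
def IsNExpansive (n : ℕ) (f : X ≃ₜ X) : Prop :=
  ∃ c : ℝ, 0 < c ∧ ∀ x : X, (dynamicBall f x c).encard ≤ n

/-- A two-sided `δ`-pseudo-orbit of `f`. -/
def IsPseudoOrbit (f : X ≃ₜ X) (δ : ℝ) (x : ℤ → X) : Prop :=
  ∀ k : ℤ, dist (f (x k)) (x (k + 1)) < δ

/-- The two-sided sequence `x` is `ε`-shadowed by the orbit of some point. -/
def IsShadowed (f : X ≃ₜ X) (ε : ℝ) (x : ℤ → X) : Prop :=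
  ∃ y : X, ∀ k : ℤ, dist ((f ^ k) y) (x k) < ε

/-- The shadowing property. -/
def HasShadowing (f : X ≃ₜ X) : Prop :=
  ∀ ε : ℝ, 0 < ε → ∃ δ : ℝ, 0 < δ ∧ ∀ x : ℤ → X, IsPseudoOrbit f δ x → IsShadowed f ε x

/-- A (one-sided) limit pseudo-orbit of `f`. -/
def IsLimitPseudoOrbit (f : X ≃ₜ X) (x : ℕ → X) : Prop :=
  Tendsto (fun k : ℕ => dist (f (x k)) (x (k + 1))) atTop (𝓝 0)

/-- The one-sided sequence `x` is limit-shadowed by the orbit of some point. -/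
def IsLimitShadowed (f : X ≃ₜ X) (x : ℕ → X) : Prop :=
  ∃ y : X, Tendsto (fun k : ℕ => dist ((f ^ k) y) (x k)) atTop (𝓝 0)

/-- The limit shadowing property. -/
def HasLimitShadowing (f : X ≃ₜ X) : Prop :=
  ∀ x : ℕ → X, IsLimitPseudoOrbit f x → IsLimitShadowed f x

/-- A two-sided limit pseudo-orbit of `f`; the filter `atBot ⊔ atTop` on `ℤ` expresses
`|k| → ∞`. -/
def IsTwoSidedLimitPseudoOrbit (f : X ≃ₜ X) (x : ℤ → X) : Prop :=
  Tendsto (fun k : ℤ => dist (f (x k)) (x (k + 1))) (atBot ⊔ atTop) (𝓝 0)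

/-- The two-sided sequence `x` is two-sided limit shadowed by the orbit of some point. -/
def IsTwoSidedLimitShadowed (f : X ≃ₜ X) (x : ℤ → X) : Prop :=
  ∃ y : X, Tendsto (fun k : ℤ => dist ((f ^ k) y) (x k)) (atBot ⊔ atTop) (𝓝 0)

/-- The two-sided limit shadowing property. -/
def HasTwoSidedLimitShadowing (f : X ≃ₜ X) : Prop :=
  ∀ x : ℤ → X, IsTwoSidedLimitPseudoOrbit f x → IsTwoSidedLimitShadowed f x

/-- `f` is topologically mixing: for all non-empty open `U`, `V`, the set `f ^ j (U)` meets `V`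
for all sufficiently large `j`. -/
def IsTopologicallyMixing (f : X ≃ₜ X) : Prop :=
  ∀ U V : Set X, IsOpen U → U.Nonempty → IsOpen V → V.Nonempty →
    ∃ k : ℕ, ∀ j : ℕ, k ≤ j → ((f ^ j) '' U ∩ V).Nonempty

end NExpansive

namespace NExpansive

open Filter Topology

variable {X : Type*} [MetricSpace X]

/-! Shadowing yields points `y m` whose orbits eventually follow the given sequence with precision
tending to 0. All but finitely many of them limit-shadow it: otherwise `n + 1` bad ones could be
chosen pairwise non-asymptotic yet eventually close. Gluing their forward orbits to backward orbits
of limit points and shadowing the result puts `n + 1` distinct points in one dynamic ball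
(`exists_asymptotic_pair`). "All but finitely many" is what settles the two-sided case: mixing gives
points following both tails at once, and the good indices for `f` and for its inverse must overlap.
-/

theorem zpow_add_apply (f : X ≃ₜ X) (a b : ℤ) (x : X) : (f ^ (a + b)) x = (f ^ a) ((f ^ b) x) := by
  rw [zpow_add]; rfl

theorem apply_zpow (f : X ≃ₜ X) (a : ℤ) (x : X) : f ((f ^ a) x) = (f ^ (a + 1)) x := by
  rw [add_comm, zpow_add_apply, zpow_one]

theorem symm_zpow (f : X ≃ₜ X) (a : ℤ) : f.symm ^ a = f ^ (-a) := by
  rw [zpow_neg, ← inv_zpow]; rfl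

theorem IsNExpansive.symm {n : ℕ} {f : X ≃ₜ X} (h : IsNExpansive n f) : IsNExpansive n f.symm := by
  obtain ⟨c, hc, h⟩ := h
  refine ⟨c, hc, fun x => (Set.encard_le_encard fun y hy m => ?_).trans (h x)⟩
  simpa [symm_zpow] using hy (-m)

/-- Reversing time turns a pseudo-orbit of `f.symm` into one of `f`, with the error controlled by
uniform continuity of `f`. -/
theorem HasShadowing.symm [CompactSpace X] {f : X ≃ₜ X} (h : HasShadowing f) :
    HasShadowing f.symm := by
  intro ε hε
  obtain ⟨δ, hδ, h⟩ := h ε hε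
  obtain ⟨δ', hδ', hf⟩ := Metric.uniformContinuous_iff.1
    (CompactSpace.uniformContinuous_of_continuous f.continuous) δ hδ
  refine ⟨δ', hδ', fun x hx => ?_⟩
  obtain ⟨y, hy⟩ := h (fun k => x (-k)) fun k => by
    have := hf (hx (-k - 1))
    rw [Homeomorph.apply_symm_apply, dist_comm] at this
    simpa [sub_eq_add_neg, add_comm] using this
  refine ⟨y, fun k => ?_⟩
  simpa [symm_zpow] using hy (-k)

/-- In an `n`-expansive system with shadowing, among `n + 1` points whose forward orbits
eventually stay close to each other, two are forward asymptotic. -/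
theorem exists_asymptotic_pair [CompactSpace X] {n : ℕ} {f : X ≃ₜ X} {c : ℝ} (hc : 0 < c)
    (hexp : ∀ x : X, (dynamicBall f x c).encard ≤ n) (hsh : HasShadowing f)
    (y : Fin (n + 1) → X)
    (hy : ∀ i j, ∀ᶠ k : ℕ in atTop, dist ((f ^ k) (y i)) ((f ^ k) (y j)) ≤ c / 2) :
    ∃ i j, i ≠ j ∧
      Tendsto (fun k : ℕ => dist ((f ^ k) (y i)) ((f ^ k) (y j))) atTop (𝓝 0) := by
  by_contra! hcon
  -- Phrased with `𝓝[>] 0` so that one `η` serves all the finitely many pairs.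
  have hsep : ∀ᶠ η : ℝ in 𝓝[>] 0, ∀ i j, i ≠ j →
      ∃ᶠ k : ℕ in atTop, η ≤ dist ((f ^ k) (y i)) ((f ^ k) (y j)) := by
    refine eventually_all.2 fun i => eventually_all.2 fun j => ?_
    by_cases hij : i = j
    · simp [hij]
    have := hcon i j hij
    rw [Metric.tendsto_nhds] at this
    push Not at this
    obtain ⟨η, hη, hfr⟩ := this
    filter_upwards [Ioo_mem_nhdsGT hη] with η' hη' _
    refine hfr.mono fun k hk => ?_
    rw [Real.dist_0_eq_abs, abs_of_nonneg dist_nonneg] at hk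
    exact hη'.2.le.trans hk
  obtain ⟨η, hη, hη0⟩ := (hsep.and self_mem_nhdsWithin).exists
  replace hη0 : 0 < η := hη0
  -- `η / 3`: a common shadowing point would force distance below `η`. `c / 4`: the dynamic ball
  -- needs `c / 4 + c / 2 + c / 4 = c`.
  obtain ⟨δ, hδ, hshad⟩ := hsh (min (η / 3) (c / 4)) (by positivity)
  obtain ⟨t, φ, hφ, ht⟩ := CompactSpace.tendsto_subseq
    (fun (k : ℕ) (i : Fin (n + 1)) => (f ^ k) (y i))
  rw [tendsto_pi_nhds] at ht
  have hall : ∀ᶠ k : ℕ in atTop, ∀ i j, dist ((f ^ k) (y i)) ((f ^ k) (y j)) ≤ c / 2 :=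
    eventually_all.2 fun i => eventually_all.2 fun j => hy i j
  obtain ⟨N₀, hN₀⟩ := eventually_atTop.1 hall
  -- Time `m` at the limit is a limit of times `m + φ k`, which are eventually past `N₀`, even for
  -- negative `m`.
  have htt : ∀ (m : ℤ) i j, dist ((f ^ m) (t i)) ((f ^ m) (t j)) ≤ c / 2 := by
    intro m i j
    have hcont : ∀ i, Tendsto (fun k => (f ^ m) ((f ^ (φ k)) (y i))) atTop (𝓝 ((f ^ m) (t i))) :=
      fun i => ((f ^ m).continuous.tendsto _).comp (ht i)
    refine le_of_tendsto ((hcont i).dist (hcont j)) ?_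
    filter_upwards [hφ.tendsto_atTop.eventually_ge_atTop (N₀ + m.natAbs)] with k hk
    have key : ∀ i, (f ^ m) ((f ^ (φ k)) (y i)) = (f ^ (m + φ k).toNat) (y i) := by
      intro i
      rw [← zpow_natCast f (φ k), ← zpow_add_apply, ← zpow_natCast, Int.toNat_of_nonneg (by omega)]
    rw [key, key]
    exact hN₀ _ (by omega) i j
  obtain ⟨N, hN, hNt⟩ : ∃ N, N₀ ≤ N ∧ ∀ i, dist (t i) ((f ^ N) (y i)) < δ := by
    have h1 : ∀ᶠ k in atTop, ∀ i, dist (t i) ((f ^ (φ k)) (y i)) < δ :=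
      eventually_all.2 fun i => by
        filter_upwards [Metric.tendsto_nhds.1 (ht i) δ hδ] with k hk
        rwa [dist_comm]
    obtain ⟨k, hk, hk'⟩ := (h1.and (hφ.tendsto_atTop.eventually_ge_atTop N₀)).exists
    exact ⟨φ k, hk', hk⟩
  -- Past of `t i`, then future of `y i` from time `N`: the only jump is at time 0.
  have hu : ∀ i, ∃ u : X, ∀ k : ℤ, dist ((f ^ k) u)
      (if k < 0 then (f ^ k) (t i) else (f ^ (N + k)) (y i)) < min (η / 3) (c / 4) := by
    intro i
    refine hshad (fun k => if k < 0 then (f ^ k) (t i) else (f ^ (N + k)) (y i)) fun k => ?_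
    dsimp only
    rcases lt_trichotomy (k + 1) 0 with h | h | h
    · rw [if_pos (by omega), if_pos h, apply_zpow, dist_self]
      exact hδ
    · rw [if_pos (by omega), if_neg (by omega), apply_zpow, h, add_zero, zpow_zero, zpow_natCast]
      exact hNt i
    · rw [if_neg (by omega), if_neg (by omega), apply_zpow, add_assoc, dist_self]
      exact hδ
  choose u hu using hu
  have hinj : Function.Injective u := by
    intro i j hij
    by_contra hne
    obtain ⟨k, hk, hkη⟩ := (hη i j hne).forall_exists_of_atTop N
    have hi := hu i (k - N)
    have hj := hu j (k - N)
    rw [if_neg (by omega), add_sub_cancel, zpow_natCast] at hi hj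
    rw [hij] at hi
    have := dist_triangle_left ((f ^ k) (y i)) ((f ^ k) (y j)) ((f ^ ((k : ℤ) - N)) (u j))
    have := min_le_left (η / 3) (c / 4)
    linarith
  have hsub : Set.range u ⊆ dynamicBall f (u 0) c := by
    rintro _ ⟨i, rfl⟩ m
    have hi := hu i m
    have h0 := hu 0 m
    have hmin := min_le_right (η / 3) (c / 4)
    rw [dist_comm] at hi
    split_ifs at hi h0 with hm
    · have := dist_triangle4 ((f ^ m) (u 0)) ((f ^ m) (t 0)) ((f ^ m) (t i)) ((f ^ m) (u i))
      have := htt m 0 i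
      linarith
    · have := dist_triangle4 ((f ^ m) (u 0)) ((f ^ (N + m)) (y 0)) ((f ^ (N + m)) (y i))
        ((f ^ m) (u i))
      have := hN₀ (N + m).toNat (by omega) 0 i
      rw [← zpow_natCast, Int.toNat_of_nonneg (by omega)] at this
      linarith
  have hcard := (Set.encard_le_encard hsub).trans (hexp (u 0))
  rw [← Set.image_univ, hinj.encard_image, Set.encard_univ, ENat.card_eq_coe_fintype_card,
    Fintype.card_fin] at hcard
  have := ENat.natCast_le_natCast.1 hcard
  omega

/-- If the points `y m` shadow tails of `x` with a precision tending to `0`, then all but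
finitely many of them limit-shadow `x`. -/
theorem eventually_tendsto_dist_zero [CompactSpace X] {n : ℕ} {f : X ≃ₜ X}
    (hexp : IsNExpansive n f) (hsh : HasShadowing f) (x y : ℕ → X)
    (hy : ∀ ε : ℝ, 0 < ε → ∀ᶠ m in atTop, ∀ᶠ k in atTop, dist ((f ^ k) (y m)) (x k) < ε) :
    ∀ᶠ m in atTop, Tendsto (fun k : ℕ => dist ((f ^ k) (y m)) (x k)) atTop (𝓝 0) := by
  obtain ⟨c, hc, hexp⟩ := hexp
  by_contra hbad
  rw [not_eventually] at hbad
  -- A point asymptotic to `y m'` for arbitrarily large `m'` inherits their precision, hence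
  -- limit-shadows `x`.
  have hfin : ∀ m, ¬ Tendsto (fun k : ℕ => dist ((f ^ k) (y m)) (x k)) atTop (𝓝 0) →
      ∀ᶠ m' in atTop,
        ¬ Tendsto (fun k : ℕ => dist ((f ^ k) (y m)) ((f ^ k) (y m'))) atTop (𝓝 0) := by
    intro m hm
    contrapose! hm
    rw [Metric.tendsto_nhds]
    intro ε hε
    obtain ⟨m', hm', hclose⟩ := (hm.and_eventually (hy (ε / 2) (half_pos hε))).exists
    filter_upwards [Metric.tendsto_nhds.1 hm' (ε / 2) (half_pos hε), hclose]
      with k h1 h2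
    rw [Real.dist_0_eq_abs, abs_of_nonneg dist_nonneg] at h1 ⊢
    have := dist_triangle ((f ^ k) (y m)) ((f ^ k) (y m')) (x k)
    linarith
  obtain ⟨g, hg, hgr⟩ := exists_seq_of_forall_finset_exists
    (fun m => (¬ Tendsto (fun k : ℕ => dist ((f ^ k) (y m)) (x k)) atTop (𝓝 0)) ∧
      ∀ᶠ k in atTop, dist ((f ^ k) (y m)) (x k) < c / 4)
    (fun m m' => ¬ Tendsto (fun k : ℕ => dist ((f ^ k) (y m)) ((f ^ k) (y m'))) atTop (𝓝 0))
    (fun s hs => by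
      obtain ⟨m, hm, hm'⟩ := (hbad.and_eventually ((hy (c / 4) (by positivity)).and
        ((Finset.eventually_all s).2 fun a ha => hfin a (hs a ha).1))).exists
      exact ⟨m, ⟨hm, hm'.1⟩, hm'.2⟩)
  obtain ⟨i, j, hij, hlim⟩ := exists_asymptotic_pair hc hexp hsh
    (fun i : Fin (n + 1) => y (g i)) fun i j => by
      filter_upwards [(hg i).2, (hg j).2] with k h1 h2
      have := dist_triangle_right ((f ^ k) (y (g i))) ((f ^ k) (y (g j))) (x k)
      linarith
  rcases lt_or_gt_of_ne hij with h | h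
  · exact hgr i j h hlim
  · exact hgr j i h (by simpa only [dist_comm] using hlim)

theorem hasLimitShadowing [CompactSpace X] {n : ℕ} {f : X ≃ₜ X} (hexp : IsNExpansive n f)
    (hsh : HasShadowing f) : HasLimitShadowing f := by
  intro x hx
  have hex : ∀ ε : ℝ, 0 < ε → ∃ y : X, ∀ᶠ k : ℕ in atTop, dist ((f ^ k) y) (x k) < ε := by
    intro ε hε
    obtain ⟨δ, hδ, h⟩ := hsh ε hε
    obtain ⟨N, hN⟩ := eventually_atTop.1 (Metric.tendsto_nhds.1 hx δ hδ)
    -- The exact backward orbit of `x N` replaces the uncontrolled initial segment.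
    obtain ⟨y, hy⟩ := h (fun k => if k < N then (f ^ (k - N)) (x N) else x k.toNat) fun k => by
      dsimp only
      rcases lt_trichotomy (k + 1) N with h | h | h
      · rw [if_pos (by omega), if_pos h, apply_zpow, sub_add_eq_add_sub, dist_self]
        exact hδ
      · rw [if_pos (by omega), if_neg (by omega), apply_zpow, sub_add_eq_add_sub, h, sub_self,
          zpow_zero, Int.toNat_natCast]
        simpa using hδ
      · rw [if_neg (by omega), if_neg (by omega)]
        have := hN k.toNat (by omega)
        rw [Real.dist_0_eq_abs, abs_of_nonneg dist_nonneg] at this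
        rwa [show (k + 1).toNat = k.toNat + 1 by omega]
    refine ⟨y, ?_⟩
    filter_upwards [eventually_ge_atTop N] with k hk
    have := hy k
    dsimp only at this
    rwa [if_neg (by omega), zpow_natCast, Int.toNat_natCast] at this
  choose y hy using fun m : ℕ => hex (1 / ((m : ℝ) + 1)) (by positivity)
  obtain ⟨m, hm⟩ := (eventually_tendsto_dist_zero hexp hsh x y fun ε hε => by
    filter_upwards [tendsto_one_div_add_atTop_nhds_zero_nat.eventually_lt_const hε] with m hm
    exact (hy m).mono fun k hk => hk.trans hm).exists
  exact ⟨y m, hm⟩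

/-- Mixing, uniformly in the target: after `j` steps, for any large `j`, the image of a given
ball is `δ`-dense. -/
theorem IsTopologicallyMixing.eventually_forall_exists [CompactSpace X] {f : X ≃ₜ X}
    (h : IsTopologicallyMixing f) (q : X) {δ : ℝ} (hδ : 0 < δ) :
    ∀ᶠ j : ℕ in atTop, ∀ z : X, ∃ a : X, dist q a < δ ∧ dist ((f ^ j) a) z < δ := by
  obtain ⟨s, -, hs⟩ := (isCompact_univ (X := X)).finite_cover_balls (half_pos hδ)
  have hball : ∀ᶠ j : ℕ in atTop, ∀ w ∈ s,
      ((f ^ j) '' Metric.ball q δ ∩ Metric.ball w (δ / 2)).Nonempty := by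
    rw [eventually_all_finite hs.1]
    intro w _
    obtain ⟨k, hk⟩ := h (Metric.ball q δ) (Metric.ball w (δ / 2)) Metric.isOpen_ball
      ⟨q, Metric.mem_ball_self hδ⟩ Metric.isOpen_ball ⟨w, Metric.mem_ball_self (half_pos hδ)⟩
    exact eventually_atTop.2 ⟨k, hk⟩
  filter_upwards [hball] with j hj z
  obtain ⟨w, hw, hzw⟩ := Set.mem_iUnion₂.1 (hs.2 (Set.mem_univ z))
  obtain ⟨_, ⟨a, ha, rfl⟩, haw⟩ := hj w hw
  rw [Metric.mem_ball] at ha hzw haw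
  refine ⟨a, by rwa [dist_comm], ?_⟩
  have := dist_triangle_right ((f ^ j) a) z w
  linarith

/-- In a mixing system with shadowing, both tails of a two-sided limit pseudo-orbit can be
shadowed by a single orbit. -/
theorem exists_shadowing_tails [CompactSpace X] {f : X ≃ₜ X} (hsh : HasShadowing f)
    (hmix : IsTopologicallyMixing f) {x : ℤ → X} (hx : IsTwoSidedLimitPseudoOrbit f x)
    {ε : ℝ} (hε : 0 < ε) :
    ∃ y : X, (∀ᶠ k : ℤ in atTop, dist ((f ^ k) y) (x k) < ε) ∧
      ∀ᶠ k : ℤ in atBot, dist ((f ^ k) y) (x k) < ε := by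
  obtain ⟨δ, hδ, h⟩ := hsh ε hε
  have hx' := Metric.tendsto_nhds.1 hx δ hδ
  simp only [eventually_sup, Real.dist_0_eq_abs, abs_of_nonneg dist_nonneg] at hx'
  obtain ⟨A, hA⟩ := eventually_atBot.1 hx'.1
  obtain ⟨B, hB⟩ := eventually_atTop.1 hx'.2
  -- `K ≥ B - A` makes the splice rejoin `x` only after time `B`.
  obtain ⟨K, hK, hK1⟩ := ((hmix.eventually_forall_exists (f (x A)) hδ).and
    (eventually_ge_atTop (B - A).toNat)).exists
  -- the splice is `x` up to time `A`, the orbit of `a` from `A + 1`, and `x` from `A + 1 + K`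
  obtain ⟨a, ha, haK⟩ := hK (x (A + 1 + K))
  obtain ⟨y, hy⟩ := h (fun k => if k ≤ A then x k else
      if k < A + 1 + K then (f ^ (k - (A + 1))) a else x k) fun k => by
    dsimp only
    by_cases h1 : k + 1 ≤ A
    · rw [if_pos (by omega), if_pos h1]
      exact hA k (by omega)
    by_cases h2 : k ≤ A
    · obtain rfl : k = A := by omega
      rw [if_pos h2, if_neg h1]
      split_ifs with h3
      · simpa using ha
      · obtain rfl : K = 0 := by omega
        exact hA k le_rfl
    by_cases h3 : k + 1 < A + 1 + K
    · rw [if_neg h2, if_neg h1, if_pos (by omega), if_pos h3, apply_zpow, sub_add_eq_add_sub,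
        dist_self]
      exact hδ
    rw [if_neg h2, if_neg h1, if_neg h3]
    split_ifs with h4
    · rw [apply_zpow, show k - (A + 1) + 1 = K by omega, zpow_natCast,
        show k + 1 = A + 1 + K by omega]
      exact haK
    · exact hB k (by omega)
  refine ⟨y, ?_, ?_⟩
  · filter_upwards [eventually_ge_atTop (A + 1 + K)] with k hk
    have := hy k
    dsimp only at this
    rwa [if_neg (by omega), if_neg (by omega)] at this
  · filter_upwards [eventually_le_atBot A] with k hk
    have := hy k
    dsimp only at this
    rwa [if_pos hk] at this

theorem hasTwoSidedLimitShadowing [CompactSpace X] {n : ℕ} {f : X ≃ₜ X}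
    (hexp : IsNExpansive n f) (hsh : HasShadowing f) (hmix : IsTopologicallyMixing f) :
    HasTwoSidedLimitShadowing f := by
  intro x hx
  choose y hyT hyB using fun m : ℕ => exists_shadowing_tails hsh hmix hx
    (ε := 1 / ((m : ℝ) + 1)) (by positivity)
  have hfor := eventually_tendsto_dist_zero hexp hsh (fun k => x k) y fun ε hε => by
    filter_upwards [tendsto_one_div_add_atTop_nhds_zero_nat.eventually_lt_const hε] with m hm
    filter_upwards [tendsto_natCast_atTop_atTop.eventually (hyT m)] with k hk
    rw [zpow_natCast] at hk
    exact hk.trans hm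
  have hneg : Tendsto (fun k : ℕ => -(k : ℤ)) atTop atBot :=
    tendsto_neg_atTop_atBot.comp tendsto_natCast_atTop_atTop
  have hback := eventually_tendsto_dist_zero hexp.symm hsh.symm (fun k => x (-k)) y fun ε hε => by
    filter_upwards [tendsto_one_div_add_atTop_nhds_zero_nat.eventually_lt_const hε] with m hm
    filter_upwards [hneg.eventually (hyB m)] with k hk
    rw [← symm_zpow, zpow_natCast] at hk
    exact hk.trans hm
  obtain ⟨m, hm, hm'⟩ := (hfor.and hback).exists
  refine ⟨y m, tendsto_sup.2 ⟨?_, ?_⟩⟩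
  · have hnat : Tendsto Int.natAbs atBot atTop := tendsto_atTop.2 fun b => by
      filter_upwards [eventually_le_atBot (-b : ℤ)] with k hk
      omega
    refine (hm'.comp hnat).congr' ?_
    filter_upwards [eventually_le_atBot 0] with k hk
    have hk' : -(k.natAbs : ℤ) = k := by omega
    simp only [Function.comp_apply]
    rw [← zpow_natCast, symm_zpow, hk']
  · have hnat : Tendsto Int.natAbs atTop atTop := tendsto_atTop.2 fun b => by
      filter_upwards [eventually_ge_atTop (b : ℤ)] with k hk
      omega
    refine (hm.comp hnat).congr' ?_
    filter_upwards [eventually_ge_atTop 0] with k hk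
    have hk' : (k.natAbs : ℤ) = k := by omega
    simp only [Function.comp_apply]
    rw [← zpow_natCast, hk']

end NExpansive

theorem theorem3 {X : Type*} [MetricSpace X] [CompactSpace X] (n : ℕ) (f : X ≃ₜ X)
    (hexp : NExpansive.IsNExpansive n f) (hsh : NExpansive.HasShadowing f) :
    NExpansive.HasLimitShadowing f ∧ NExpansive.HasLimitShadowing f.symm ∧
      (NExpansive.IsTopologicallyMixing f → NExpansive.HasTwoSidedLimitShadowing f) :=
  ⟨NExpansive.hasLimitShadowing hexp hsh, NExpansive.hasLimitShadowing hexp.symm hsh.symm,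
    NExpansive.hasTwoSidedLimitShadowing hexp hsh⟩
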